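/- Quantum query model. Let $\mathbb F$ be a finite field. A quantum query algorithm with oracle access to a matrix $M\in\mathbb F^{r\times c}$ and a vector $v\in\mathbb F^c$ acts on a finite-dimensional space with a matrix query register, a vector query register, an output register with basis $\mathbb F^r$, and a workspace; starting from a fixed basis state it alternates unitaries that do not depend on $(M,v)$ with queries, each to $U_M:|j,k,z\rangle\mapsto|j,k,z+M_{jk}\rangle$, to $U_v:|j,z\rangle\mapsto|j,z+v_j\rangle$, or to one of the adjoints $U_M^\dagger,U_v^\dagger$. Then $\Pr_{\mathsf{ALG}}[\mathsf{ALG}^{M,v}=Mv]$ is the probability that measuring the output register of the final state in the standard basis gives $Mv$. Statement. There is an absolute constant $C>0$ such that the following holds. Let $\mathbb F$ be a finite field (in particular any prime field $\mathbb F_p$), let $n\ge 1$, let $k$ be a divisor of $n$, let $d=n/k$, and let $\alpha\in(0,1]$ satisfy $\alpha\ge 4\exp(-k/3200)$. Let $\mathsf{ALG}$ be a quantum query algorithm for $n\times n$ matrices that makes $Q$ queries to $U_M$ and $U_M^\dagger$ and $Q'$ queries to $U_v$ and $U_v^\dagger$, and that satisfies, for uniformly random $M\in\mathbb F^{n\times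 n}$ and $v\in\mathbb F^n$, \[\Pr_{M,v,\mathsf{ALG}}[\mathsf{ALG}^{M,v}=Mv]\ge\alpha .\] Call $v\in\mathbb F^n$ good if $\Pr_{M,\mathsf{ALG}}[\mathsf{ALG}^{M,v}=Mv]\ge\alpha/2$ for uniformly random $M\in\mathbb F^{n\times n}$. Then there is a quantum query algorithm $\mathsf{ALG}_2$ with oracle access to a matrix in $\mathbb F^{d\times n}$ and a vector in $\mathbb F^n$ that makes at most $C\,\alpha^{-1}(Q+n^{3/2})$ queries to $U_M$ and $U_M^\dagger$, makes at most $C\,\alpha^{-1}(Q'+n^{3/2})$ queries to $U_v$ and $U_v^\dagger$, and satisfies \[\Pr_{\mathsf{ALG}_2}[\mathsf{ALG}_2^{M,v}=Mv]\ge 0.96\qquad\text{for every good } v\in\mathbb F^n \text{ and every } M\in\mathbb F^{d\times n}.\] -/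

import Mathlib

open scoped Matrix

/-- Computational basis of the state space of a query algorithm for `r × c` matrices over `F`:
a matrix query register `|j, k, z⟩`, a vector query register `|j, z⟩`, an output register
holding a vector of `F ^ r`, and a workspace of dimension `w`. -/
abbrev QBasis (F : Type*) (r c w : ℕ) : Type _ :=
  (Fin r × Fin c × F) × (Fin c × F) × (Fin r → F) × Fin w

section Oracles

variable {F : Type*} [Field F] {r c w : ℕ}

/-- The oracle `U_M` on basis states: `|j, k, z⟩ ↦ |j, k, z + M j k⟩`. -/
def matrixOracle (M : Matrix (Fin r) (Fin c) F) : Equiv.Perm (QBasis F r c w) where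
  toFun b := ((b.1.1, b.1.2.1, b.1.2.2 + M b.1.1 b.1.2.1), b.2)
  invFun b := ((b.1.1, b.1.2.1, b.1.2.2 - M b.1.1 b.1.2.1), b.2)
  left_inv b := by simp
  right_inv b := by simp

/-- The oracle `U_v` on basis states: `|j, z⟩ ↦ |j, z + v j⟩`. -/
def vectorOracle (v : Fin c → F) : Equiv.Perm (QBasis F r c w) where
  toFun b := (b.1, (b.2.1.1, b.2.1.2 + v b.2.1.1), b.2.2)
  invFun b := (b.1, (b.2.1.1, b.2.1.2 - v b.2.1.1), b.2.2)
  left_inv b := by simp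
  right_inv b := by simp

/-- The four kinds of query: `U_M`, its adjoint, `U_v`, its adjoint. -/
inductive QueryKind where
  | mat
  | matAdj
  | vec
  | vecAdj

/-- Queries to `U_M` or to its adjoint. -/
def QueryKind.isMat : QueryKind → Bool
  | mat => true
  | matAdj => true
  | vec => false
  | vecAdj => false

/-- The basis permutation performed by a query. -/
def QueryKind.perm (M : Matrix (Fin r) (Fin c) F) (v : Fin c → F) :
    QueryKind → Equiv.Perm (QBasis F r c w)
  | mat => matrixOracle M
  | matAdj => (matrixOracle M).symm
  | vec => vectorOracle v
  | vecAdj => (vectorOracle v).symm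

/-- The unitary performed by a query on a state `ψ = ∑ b, ψ b |b⟩`: it sends `|b⟩` to
`|perm b⟩`. -/
def QueryKind.apply (q : QueryKind) (M : Matrix (Fin r) (Fin c) F) (v : Fin c → F)
    (ψ : QBasis F r c w → ℂ) : QBasis F r c w → ℂ :=
  fun b => ψ ((q.perm M v).symm b)

end Oracles

/-- A quantum query algorithm with oracle access to an `r × c` matrix and to a vector of `F ^ c`:
starting from a fixed basis state, it applies a unitary, and then alternates between oracle queries
and unitaries. None of these data depends on the matrix or on the vector. -/
structure QueryAlgorithm (F : Type*) [Field F] [Fintype F] [DecidableEq F] (r c : ℕ) where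
  work : ℕ
  start : QBasis F r c work
  initial : Matrix.unitaryGroup (QBasis F r c work) ℂ
  steps : List (QueryKind × Matrix.unitaryGroup (QBasis F r c work) ℂ)

namespace QueryAlgorithm

variable {F : Type*} [Field F] [Fintype F] [DecidableEq F] {r c : ℕ}

/-- The number of queries to `U_M` and to its adjoint. -/
def matrixQueries (A : QueryAlgorithm F r c) : ℕ :=
  A.steps.countP fun s => s.1.isMat

/-- The number of queries to `U_v` and to its adjoint. -/
def vectorQueries (A : QueryAlgorithm F r c) : ℕ :=
  A.steps.countP fun s => !s.1.isMat

/-- The final state of the algorithm, before the measurement. -/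
noncomputable def finalState (A : QueryAlgorithm F r c) (M : Matrix (Fin r) (Fin c) F)
    (v : Fin c → F) : QBasis F r c A.work → ℂ :=
  A.steps.foldl (fun ψ s => (s.2 : Matrix _ _ ℂ) *ᵥ s.1.apply M v ψ)
    ((A.initial : Matrix _ _ ℂ) *ᵥ Pi.single A.start 1)

/-- The probability of reading `y` when the output register of the final state is measured in the
standard basis, i.e. the squared norm of the projection of that state. -/
noncomputable def outputProb (A : QueryAlgorithm F r c) (M : Matrix (Fin r) (Fin c) F)
    (v : Fin c → F) (y : Fin r → F) : ℝ :=
  ∑ b : QBasis F r c A.work with b.2.2.1 = y, ‖A.finalState M v b‖ ^ 2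

/-- The probability that the algorithm outputs `M v` on the input `(M, v)`. -/
noncomputable def successProb (A : QueryAlgorithm F r c) (M : Matrix (Fin r) (Fin c) F)
    (v : Fin c → F) : ℝ :=
  A.outputProb M v (M *ᵥ v)

/-- The success probability on a fixed vector, over a uniformly random matrix. -/
noncomputable def vectorSuccess (A : QueryAlgorithm F r c) (v : Fin c → F) : ℝ :=
  (∑ M : Matrix (Fin r) (Fin c) F, A.successProb M v) /
    (Fintype.card (Matrix (Fin r) (Fin c) F) : ℝ)

/-- The success probability over a uniformly random matrix and a uniformly random vector. -/
noncomputable def averageSuccess (A : QueryAlgorithm F r c) : ℝ :=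
  (∑ M : Matrix (Fin r) (Fin c) F, ∑ v : Fin c → F, A.successProb M v) /
    ((Fintype.card (Matrix (Fin r) (Fin c) F) : ℝ) * (Fintype.card (Fin c → F) : ℝ))

/-- A vector is good if the algorithm succeeds on it with probability at least `α / 2`. -/
def IsGood (A : QueryAlgorithm F r c) (α : ℝ) (v : Fin c → F) : Prop :=
  α / 2 ≤ A.vectorSuccess v

end QueryAlgorithm

/-!
The new algorithm repeats one trial `T = ⌈8 / α⌉` times. It first copies `v` into its workspace with
`2 n` vector queries, so that afterwards everything except the entries of `M` is known to it.

In a trial the `n` rows are split into `k` blocks of `d` rows. The seed of the trial consists of a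
uniform mask `R` and a uniform set `S` of blocks, and `ALG` is run on `R` plus a copy of `M` in each
block of `S` (`Seed.plant`). This matrix is uniform and independent of `S` (`Seed.sum_plant`), so
on a good vector all blocks of the output are right with probability at least `α / 2`
(`prob_correct_eq`). Subtracting `R v` from the output leaves proposals, one for each block: the
right ones are `M v` on `S` and `0` off `S`. The trial accepts `u` if all proposals off `S` vanish
and a strict majority of those on `S` are equal to `u`.

For a wrong value to be accepted, `S` has to contain all wrong blocks and at most as many correct
blocks as wrong ones (`Seed.Accepts.eq`). As `S` is independent of the set of wrong blocks, this has
probability at most `(5 / 6) ^ k` (`card_planted_sets_le`, `prob_badSet_le`), which is negligible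
compared with `α`. Hence, with probability at least `1 - T (5 / 6) ^ k - (1 - α / 2) ^ T`, some
trial is right and none accepts a wrong value (`le_sum_prod_trials`, `decode_eq`).

On the quantum side, `Reach a b ψ` says that the family of states `ψ M v` is the final state of an
algorithm with at most `a` matrix and `b` vector queries. Seeds are held in uniform superposition
next to the registers of their run; one query of a run costs two queries to `M`, which compute an
entry of `M` and erase it again (`Reach.simQuery`). The `T` runs occupy different tensor factors
(`Reach.runTrials`), so that measuring them gives `T` independent trials
(`exists_queryAlgorithm_trials`).
-/

/-! ### Reachable families of states -/

/-- Basis of the state space of a query algorithm whose workspace is indexed by an arbitrary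
type `W`; `QBasis F r c w` is the case `W = Fin w`. -/
abbrev RegBasis (F : Type*) (r c : ℕ) (W : Type*) : Type _ :=
  (Fin r × Fin c × F) × (Fin c × F) × (Fin r → F) × W

section Reach

variable {F : Type*} [Field F] [Fintype F] [DecidableEq F] {r c : ℕ}

namespace QueryAlgorithm

/-- A unitary applied after the last step is absorbed into the last unitary. -/
theorem exists_unitary_append (A : QueryAlgorithm F r c)
    (U : Matrix.unitaryGroup (QBasis F r c A.work) ℂ) :
    ∃ (i : Matrix.unitaryGroup (QBasis F r c A.work) ℂ)
      (l : List (QueryKind × Matrix.unitaryGroup (QBasis F r c A.work) ℂ)),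
      l.map Prod.fst = A.steps.map Prod.fst ∧
      ∀ M v, (QueryAlgorithm.mk A.work A.start i l).finalState M v =
        (U : Matrix _ _ ℂ) *ᵥ A.finalState M v := by
  obtain ⟨w, s, i, l⟩ := A
  rcases List.eq_nil_or_concat l with rfl | ⟨l', ⟨q, V⟩, rfl⟩
  · refine ⟨U * i, [], rfl, fun M v => ?_⟩
    simp only [finalState, List.foldl_nil, Matrix.mulVec_mulVec]
    rfl
  · refine ⟨i, l' ++ [(q, U * V)], by simp, fun M v => ?_⟩
    simp [finalState]

theorem matrixQueries_eq (A : QueryAlgorithm F r c) :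
    A.matrixQueries = (A.steps.map Prod.fst).countP QueryKind.isMat := by
  rw [matrixQueries, List.countP_map]; rfl

theorem vectorQueries_eq (A : QueryAlgorithm F r c) :
    A.vectorQueries = (A.steps.map Prod.fst).countP fun q => !q.isMat := by
  rw [vectorQueries, List.countP_map]; rfl

end QueryAlgorithm

/-- The family of states `ψ M v`, on a space with workspace `W`, is the final state of a query
algorithm with at most `a` matrix queries and at most `b` vector queries. -/
def Reach {W : Type*} (a b : ℕ)
    (ψ : Matrix (Fin r) (Fin c) F → (Fin c → F) → RegBasis F r c W → ℂ) : Prop :=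
  ∃ (A : QueryAlgorithm F r c) (e : Fin A.work ≃ W),
    A.matrixQueries ≤ a ∧ A.vectorQueries ≤ b ∧
    ∀ M v s, A.finalState M v s = ψ M v (s.1, s.2.1, s.2.2.1, e s.2.2.2)

variable {W : Type*} {a b : ℕ}
  {ψ : Matrix (Fin r) (Fin c) F → (Fin c → F) → RegBasis F r c W → ℂ}

theorem Reach.congr {ψ' : Matrix (Fin r) (Fin c) F → (Fin c → F) → RegBasis F r c W → ℂ}
    (h : Reach a b ψ) (h' : ∀ M v m w o x, ψ M v (m, w, o, x) = ψ' M v (m, w, o, x)) :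
    Reach a b ψ' := by
  obtain rfl : ψ = ψ' := by
    funext M v ⟨m, w, o, x⟩
    exact h' M v m w o x
  exact h

theorem Reach.relabel {W' : Type*} (h : Reach a b ψ) (e' : W' ≃ W) :
    Reach a b fun M v s => ψ M v (s.1, s.2.1, s.2.2.1, e' s.2.2.2) := by
  obtain ⟨A, e, ha, hb, hA⟩ := h
  refine ⟨A, e.trans e'.symm, ha, hb, fun M v s => ?_⟩
  simp [hA]

/-- Replacing the index of the workspace. -/
def regBasisCongr {W W' : Type*} (e : W ≃ W') : RegBasis F r c W ≃ RegBasis F r c W' :=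
  (Equiv.refl _).prodCongr ((Equiv.refl _).prodCongr ((Equiv.refl _).prodCongr e))

theorem Matrix.submatrix_equiv_mem_unitaryGroup {m n : Type*} [Fintype m] [Fintype n]
    [DecidableEq m] [DecidableEq n] (e : m ≃ n) {U : Matrix n n ℂ}
    (hU : U ∈ Matrix.unitaryGroup n ℂ) : U.submatrix e e ∈ Matrix.unitaryGroup m ℂ := by
  rw [Matrix.mem_unitaryGroup_iff] at hU ⊢
  rw [Matrix.star_eq_conjTranspose, Matrix.conjTranspose_submatrix,
    Matrix.submatrix_mul_equiv, ← Matrix.star_eq_conjTranspose, hU, Matrix.submatrix_one_equiv]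

theorem Reach.unitary [Fintype W] [DecidableEq (RegBasis F r c W)] (h : Reach a b ψ)
    {U : Matrix (RegBasis F r c W) (RegBasis F r c W) ℂ}
    (hU : U ∈ Matrix.unitaryGroup (RegBasis F r c W) ℂ) :
    Reach a b fun M v => U *ᵥ ψ M v := by
  obtain ⟨A, e, ha, hb, hA⟩ := h
  obtain ⟨i, l, hl, hf⟩ := A.exists_unitary_append
    ⟨_, Matrix.submatrix_equiv_mem_unitaryGroup (regBasisCongr e) hU⟩
  refine ⟨⟨A.work, A.start, i, l⟩, e, ?_, ?_, fun M v s => ?_⟩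
  · rw [QueryAlgorithm.matrixQueries_eq] at ha ⊢
    simpa only [hl] using ha
  · rw [QueryAlgorithm.vectorQueries_eq] at hb ⊢
    simpa only [hl] using hb
  · rw [hf]
    simp only [Matrix.mulVec, dotProduct, Matrix.submatrix_apply, hA]
    exact Fintype.sum_equiv (regBasisCongr e) _ _ fun x => rfl

theorem Matrix.permMatrix_mem_unitaryGroup {n : Type*} [Fintype n] [DecidableEq n]
    (π : Equiv.Perm n) : π.permMatrix ℂ ∈ Matrix.unitaryGroup n ℂ := by
  rw [Matrix.mem_unitaryGroup_iff, Matrix.star_eq_conjTranspose, Matrix.conjTranspose_permMatrix,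
    ← Matrix.permMatrix_mul]
  simp

theorem Reach.perm [Fintype W] (h : Reach a b ψ) (π : Equiv.Perm (RegBasis F r c W)) :
    Reach a b fun M v s => ψ M v (π.symm s) := by
  classical
  refine (h.unitary (Matrix.permMatrix_mem_unitaryGroup π.symm)).congr fun M v m w o x => ?_
  rw [Matrix.permMatrix_mulVec]
  rfl

/-- A permutation of the matrix query register, controlled by the workspace. -/
theorem Reach.ctrlMat [Fintype W] (h : Reach a b ψ) (f : W → Equiv.Perm (Fin r × Fin c × F)) :
    Reach a b fun M v s => ψ M v ((f s.2.2.2).symm s.1, s.2) :=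
  h.perm ⟨fun s => (f s.2.2.2 s.1, s.2), fun s => ((f s.2.2.2).symm s.1, s.2),
    fun s => by simp, fun s => by simp⟩

/-- A permutation of the vector query register. -/
theorem Reach.permVec [Fintype W] (h : Reach a b ψ) (f : Equiv.Perm (Fin c × F)) :
    Reach a b fun M v s => ψ M v (s.1, f.symm s.2.1, s.2.2) :=
  h.perm ⟨fun s => (s.1, f s.2.1, s.2.2), fun s => (s.1, f.symm s.2.1, s.2.2),
    fun s => by simp, fun s => by simp⟩

/-- A permutation of the output register, controlled by the workspace. -/
theorem Reach.ctrlOut [Fintype W] (h : Reach a b ψ) (f : W → Equiv.Perm (Fin r → F)) :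
    Reach a b fun M v s => ψ M v (s.1, s.2.1, (f s.2.2.2).symm s.2.2.1, s.2.2.2) :=
  h.perm ⟨fun s => (s.1, s.2.1, f s.2.2.2 s.2.2.1, s.2.2.2),
    fun s => (s.1, s.2.1, (f s.2.2.2).symm s.2.2.1, s.2.2.2),
    fun s => by simp, fun s => by simp⟩

/-- A permutation of the workspace, controlled by the two query registers. -/
theorem Reach.ctrlWork [Fintype W] (h : Reach a b ψ)
    (f : (Fin r × Fin c × F) → (Fin c × F) → Equiv.Perm W) :
    Reach a b fun M v s => ψ M v (s.1, s.2.1, s.2.2.1, (f s.1 s.2.1).symm s.2.2.2) :=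
  h.perm ⟨fun s => (s.1, s.2.1, s.2.2.1, f s.1 s.2.1 s.2.2.2),
    fun s => (s.1, s.2.1, s.2.2.1, (f s.1 s.2.1).symm s.2.2.2),
    fun s => by simp, fun s => by simp⟩

theorem Reach.query (h : Reach a b ψ) (q : QueryKind) :
    Reach (a + if q.isMat then 1 else 0) (b + if q.isMat then 0 else 1) fun M v s =>
      match q with
      | .mat => ψ M v ((s.1.1, s.1.2.1, s.1.2.2 - M s.1.1 s.1.2.1), s.2)
      | .matAdj => ψ M v ((s.1.1, s.1.2.1, s.1.2.2 + M s.1.1 s.1.2.1), s.2)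
      | .vec => ψ M v (s.1, (s.2.1.1, s.2.1.2 - v s.2.1.1), s.2.2)
      | .vecAdj => ψ M v (s.1, (s.2.1.1, s.2.1.2 + v s.2.1.1), s.2.2) := by
  obtain ⟨A, e, ha, hb, hA⟩ := h
  refine ⟨⟨A.work, A.start, A.initial, A.steps ++ [(q, 1)]⟩, e, ?_, ?_, fun M v s => ?_⟩
  · simp only [QueryAlgorithm.matrixQueries, List.countP_append, List.countP_singleton] at ha ⊢
    exact Nat.add_le_add_right ha _
  · simp only [QueryAlgorithm.vectorQueries, List.countP_append, List.countP_singleton] at hb ⊢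
    refine Nat.add_le_add hb ?_
    cases q <;> simp [QueryKind.isMat]
  · have : (QueryAlgorithm.mk A.work A.start A.initial (A.steps ++ [(q, 1)])).finalState M v =
        q.apply M v (A.finalState M v) := by
      simp [QueryAlgorithm.finalState]
    rw [this]
    cases q <;> simp [QueryKind.apply, QueryKind.perm, matrixOracle, vectorOracle, hA]

theorem Reach.mat (h : Reach a b ψ) : Reach (a + 1) b fun M v s =>
    ψ M v ((s.1.1, s.1.2.1, s.1.2.2 - M s.1.1 s.1.2.1), s.2) :=
  h.query .mat

theorem Reach.matAdj (h : Reach a b ψ) : Reach (a + 1) b fun M v s =>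
    ψ M v ((s.1.1, s.1.2.1, s.1.2.2 + M s.1.1 s.1.2.1), s.2) :=
  h.query .matAdj

theorem Reach.vec (h : Reach a b ψ) : Reach a (b + 1) fun M v s =>
    ψ M v (s.1, (s.2.1.1, s.2.1.2 - v s.2.1.1), s.2.2) :=
  h.query .vec

theorem Reach.vecAdj (h : Reach a b ψ) : Reach a (b + 1) fun M v s =>
    ψ M v (s.1, (s.2.1.1, s.2.1.2 + v s.2.1.1), s.2.2) :=
  h.query .vecAdj

/-- Every unit vector is a column of a unitary matrix. -/
theorem Matrix.exists_unitary_mulVec_single {n : Type*} [Fintype n] [DecidableEq n] (i : n)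
    {u : n → ℂ} (hu : ∑ j, ‖u j‖ ^ 2 = 1) :
    ∃ U ∈ Matrix.unitaryGroup n ℂ, U *ᵥ Pi.single i 1 = u := by
  have hnorm : ‖(WithLp.toLp 2 u : EuclideanSpace ℂ n)‖ = 1 := by
    rw [EuclideanSpace.norm_eq]
    simp [hu]
  obtain ⟨b, hb⟩ := Orthonormal.exists_orthonormalBasis_extension_of_card_eq (𝕜 := ℂ)
    (E := EuclideanSpace ℂ n) (ι := n) (by simp)
    (v := fun _ => (WithLp.toLp 2 u : EuclideanSpace ℂ n)) (s := {i}) (by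
      constructor
      · intro _; exact hnorm
      · intro x y hxy
        exact absurd (Subsingleton.elim x y) hxy)
  refine ⟨(EuclideanSpace.basisFun n ℂ).toBasis.toMatrix b,
    OrthonormalBasis.toMatrix_orthonormalBasis_mem_unitary _ _, ?_⟩
  ext j
  rw [Matrix.mulVec_single_one]
  simp [Module.Basis.toMatrix_apply, hb i rfl]

/-- Every unit vector that does not depend on the inputs is prepared without queries. -/
theorem Reach.init [Fintype W] {φ : RegBasis F r c W → ℂ} (hφ : ∑ s, ‖φ s‖ ^ 2 = 1) :
    Reach 0 0 fun (_ : Matrix (Fin r) (Fin c) F) (_ : Fin c → F) => φ := by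
  have hne : Nonempty (RegBasis F r c W) := by
    by_contra hne
    rw [not_nonempty_iff] at hne
    simp at hφ
  let e := (Fintype.equivFin W).symm
  let s₀ := (regBasisCongr e).symm hne.some
  obtain ⟨U, hU, h⟩ := Matrix.exists_unitary_mulVec_single s₀
    (u := fun s => φ (regBasisCongr e s))
    (by rw [← hφ]; exact Fintype.sum_equiv (regBasisCongr e) _ _ fun x => rfl)
  refine ⟨⟨_, s₀, ⟨U, hU⟩, []⟩, e, by simp [QueryAlgorithm.matrixQueries],
    by simp [QueryAlgorithm.vectorQueries], fun M v s => ?_⟩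
  simp only [QueryAlgorithm.finalState, List.foldl_nil, h]
  rfl

/-- A unitary `U` on a tensor factor `X` of a space `n ≃ X × R` extends to `n` as `U ⊗ 1`. -/
theorem Matrix.exists_unitary_tensor_one {n X R : Type*} [Fintype n] [Fintype X] [Fintype R]
    [DecidableEq n] [DecidableEq X] [DecidableEq R] (E : n ≃ X × R) {U : Matrix X X ℂ}
    (hU : U ∈ Matrix.unitaryGroup X ℂ) :
    ∃ V ∈ Matrix.unitaryGroup n ℂ, ∀ (φ : n → ℂ) (s : n),
      (V *ᵥ φ) s = ∑ x, U (E s).1 x * φ (E.symm (x, (E s).2)) := by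
  have hK : Matrix.kroneckerMap (· * ·) U (1 : Matrix R R ℂ) ∈ Matrix.unitaryGroup (X × R) ℂ :=
    Matrix.kronecker_mem_unitary hU (one_mem (Matrix.unitaryGroup R ℂ))
  refine ⟨_, Matrix.submatrix_equiv_mem_unitaryGroup E hK, fun φ s => ?_⟩
  simp only [Matrix.mulVec, dotProduct]
  rw [← E.symm.sum_comp, Fintype.sum_prod_type]
  refine Finset.sum_congr rfl fun y _ => ?_
  rw [Finset.sum_eq_single (E s).2]
  · simp [Matrix.kroneckerMap_apply]
  · intro t _ ht
    simp only [Matrix.submatrix_apply, Matrix.kroneckerMap_apply, Equiv.apply_symm_apply]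
    rw [Matrix.one_apply_ne ht.symm]
    simp
  · simp

/-- A unitary acting on one tensor factor of the workspace. -/
theorem Reach.localUnitary {Ω X R : Type*} [Fintype Ω] [Fintype X] [Fintype R]
    [DecidableEq X]
    {ψ : Matrix (Fin r) (Fin c) F → (Fin c → F) → RegBasis F r c ((Ω × X) × R) → ℂ}
    (h : Reach a b ψ) {U : Matrix X X ℂ} (hU : U ∈ Matrix.unitaryGroup X ℂ) :
    Reach a b fun M v (s : RegBasis F r c ((Ω × X) × R)) => ∑ x, U s.2.2.2.1.2 x *
      ψ M v (s.1, s.2.1, s.2.2.1, (s.2.2.2.1.1, x), s.2.2.2.2) := by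
  classical
  let E : RegBasis F r c ((Ω × X) × R) ≃
      X × ((Fin r × Fin c × F) × (Fin c × F) × (Fin r → F) × Ω × R) :=
    { toFun := fun s => (s.2.2.2.1.2, s.1, s.2.1, s.2.2.1, s.2.2.2.1.1, s.2.2.2.2)
      invFun := fun t => (t.2.1, t.2.2.1, t.2.2.2.1, (t.2.2.2.2.1, t.1), t.2.2.2.2.2)
      left_inv := fun _ => rfl
      right_inv := fun _ => rfl }
  obtain ⟨V, hV, hVφ⟩ := Matrix.exists_unitary_tensor_one E hU
  exact (h.unitary hV).congr fun M v m w o x => hVφ _ _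

end Reach

/-! ### Simulation of the given algorithm on a planted matrix -/

section Simulation

variable {F : Type*} [Field F] [Fintype F] [DecidableEq F]

/-- The random seed of one trial: a uniform mask for the `n × n` matrix, and the set of blocks
into which the input matrix is planted. -/
abbrev Seed (F : Type*) (n k : ℕ) : Type _ :=
  (Fin n → Fin n → F) × (Fin k → Bool)

variable {n k d : ℕ}

/-- The matrix on which one trial runs the given algorithm: rows are indexed by (block, row of the
block) through `e`, and the mask is added to copies of `M` placed in the selected blocks. -/
def Seed.plant (e : Fin n ≃ Fin k × Fin d) (ω : Seed F n k) (M : Matrix (Fin d) (Fin n) F) :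
    Matrix (Fin n) (Fin n) F :=
  Matrix.of fun j l => ω.1 j l + if ω.2 (e j).1 then M (e j).2 l else 0

variable {a b : ℕ}

/-- One query to the planted matrix costs two queries to `M`: the entry of `M` is computed into
the idle query register, used, and erased. The scalar `c` is `1` for the oracle and `-1` for its
adjoint. -/
theorem Reach.plantQuery {w : ℕ} {R : Type*} [Fintype R] (e : Fin n ≃ Fin k × Fin d)
    (j₀ : Fin d) (l₀ : Fin n) (c : F)
    {ψ : Matrix (Fin d) (Fin n) F → (Fin n → F) →
      RegBasis F d n ((Seed F n k × QBasis F n n w) × R) → ℂ}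
    (h : Reach a b ψ) :
    Reach (a + 2) b fun M v (s : RegBasis F d n ((Seed F n k × QBasis F n n w) × R)) =>
      ψ M v (s.1, s.2.1, s.2.2.1, ((s.2.2.2.1.1, ((s.2.2.2.1.2.1.1, s.2.2.2.1.2.1.2.1,
        s.2.2.2.1.2.1.2.2 - c * (s.2.2.2.1.1.1 s.2.2.2.1.2.1.1 s.2.2.2.1.2.1.2.1 +
          if s.2.2.2.1.1.2 (e s.2.2.2.1.2.1.1).1 then
            s.1.2.2 + M (Equiv.swap j₀ (e s.2.2.2.1.2.1.1).2 s.1.1)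
              (Equiv.swap l₀ s.2.2.2.1.2.1.2.1 s.1.2.1)
          else 0)), s.2.2.2.1.2.2)), s.2.2.2.2)) := by
  -- `σ` turns the idle index of the query register into the index asked for in the workspace
  let σ : (Seed F n k × QBasis F n n w) × R → Equiv.Perm (Fin d × Fin n × F) := fun y =>
    (Equiv.swap j₀ (e y.1.2.1.1).2).prodCongr
      ((Equiv.swap l₀ y.1.2.1.2.1).prodCongr (Equiv.refl F))
  let g : (Fin d × Fin n × F) → Seed F n k × QBasis F n n w → F := fun m y =>
    c * (y.1.1 y.2.1.1 y.2.1.2.1 + if y.1.2 (e y.2.1.1).1 then m.2.2 else 0)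
  let D : (Fin d × Fin n × F) → (Fin n × F) →
      Equiv.Perm ((Seed F n k × QBasis F n n w) × R) := fun m _ =>
    { toFun := fun y => ((y.1.1, ((y.1.2.1.1, y.1.2.1.2.1, y.1.2.1.2.2 + g m y.1), y.1.2.2)), y.2)
      invFun := fun y =>
        ((y.1.1, ((y.1.2.1.1, y.1.2.1.2.1, y.1.2.1.2.2 - g m y.1), y.1.2.2)), y.2)
      left_inv := fun y => by simp [g]
      right_inv := fun y => by simp [g] }
  refine (((((h.ctrlMat σ).mat).ctrlWork D).matAdj).ctrlMat fun y => (σ y).symm).congr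
    fun M v m w o x => ?_
  simp [σ, D, g]

/-- A query to the vector is simulated without queries once the vector is stored in the workspace.
The scalar `c` is `1` for the oracle and `-1` for its adjoint. -/
theorem Reach.storedQuery {w : ℕ} {R : Type*} [Fintype R] (c : F)
    {ψ : Matrix (Fin d) (Fin n) F → (Fin n → F) →
      RegBasis F d n ((Seed F n k × QBasis F n n w) × (Fin n → F) × R) → ℂ}
    (h : Reach a b ψ) :
    Reach a b fun M v
        (s : RegBasis F d n ((Seed F n k × QBasis F n n w) × (Fin n → F) × R)) =>
      ψ M v (s.1, s.2.1, s.2.2.1, ((s.2.2.2.1.1, (s.2.2.2.1.2.1, (s.2.2.2.1.2.2.1.1,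
        s.2.2.2.1.2.2.1.2 - c * s.2.2.2.2.1 s.2.2.2.1.2.2.1.1), s.2.2.2.1.2.2.2)),
        s.2.2.2.2)) := by
  let D : (Fin d × Fin n × F) → (Fin n × F) →
      Equiv.Perm ((Seed F n k × QBasis F n n w) × (Fin n → F) × R) := fun _ _ =>
    { toFun := fun y => ((y.1.1, (y.1.2.1, (y.1.2.2.1.1, y.1.2.2.1.2 + c * y.2.1 y.1.2.2.1.1),
        y.1.2.2.2)), y.2)
      invFun := fun y => ((y.1.1, (y.1.2.1, (y.1.2.2.1.1,
        y.1.2.2.1.2 - c * y.2.1 y.1.2.2.1.1), y.1.2.2.2)), y.2)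
      left_inv := fun y => by simp
      right_inv := fun y => by simp }
  exact (h.ctrlWork D).congr fun M v m w o x => rfl

/-- One query of the given algorithm, on the tensor factor that holds its registers. The factor `A`
holds everything else; it requires that the matrix query register is idle and that the
workspace stores `v`. -/
theorem Reach.simQuery {w : ℕ} {R : Type*} [Fintype R] (e : Fin n ≃ Fin k × Fin d)
    (j₀ : Fin d) (l₀ : Fin n)
    {A : Matrix (Fin d) (Fin n) F → (Fin n → F) → (Fin d × Fin n × F) → (Fin n × F) →
      (Fin d → F) → (Fin n → F) × R → ℂ}
    (hA : ∀ M v m u o r, A M v m u o r ≠ 0 → m = (j₀, l₀, 0) ∧ r.1 = v)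
    {χ : Matrix (Fin d) (Fin n) F → (Fin n → F) → Seed F n k × QBasis F n n w → ℂ}
    (h : Reach a b fun M v
        (s : RegBasis F d n ((Seed F n k × QBasis F n n w) × (Fin n → F) × R)) =>
      A M v s.1 s.2.1 s.2.2.1 s.2.2.2.2 * χ M v s.2.2.2.1) (q : QueryKind) :
    Reach (a + if q.isMat then 2 else 0) b fun M v
        (s : RegBasis F d n ((Seed F n k × QBasis F n n w) × (Fin n → F) × R)) =>
      A M v s.1 s.2.1 s.2.2.1 s.2.2.2.2 *
        q.apply (Seed.plant e s.2.2.2.1.1 M) v (fun x => χ M v (s.2.2.2.1.1, x)) s.2.2.2.1.2 := by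
  have key : ∀ {M v m u o r} {y z : ℂ}, (m = (j₀, l₀, 0) → r.1 = v → y = z) →
      A M v m u o r * y = A M v m u o r * z := by
    intro M v m u o r y z hyz
    by_cases h0 : A M v m u o r = 0
    · simp [h0]
    · obtain ⟨h1, h2⟩ := hA M v m u o r h0
      rw [hyz h1 h2]
  cases q
  · refine (h.plantQuery e j₀ l₀ 1).congr fun M v m u o x => key ?_
    rintro rfl -
    simp [QueryKind.apply, QueryKind.perm, matrixOracle, Seed.plant]
  · refine (h.plantQuery e j₀ l₀ (-1)).congr fun M v m u o x => key ?_
    rintro rfl -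
    simp [QueryKind.apply, QueryKind.perm, matrixOracle, Seed.plant, sub_eq_add_neg]
  · refine (h.storedQuery 1).congr fun M v m u o x => key ?_
    rintro - rfl
    simp [QueryKind.apply, QueryKind.perm, vectorOracle]
  · refine (h.storedQuery (-1)).congr fun M v m u o x => key ?_
    rintro - rfl
    simp [QueryKind.apply, QueryKind.perm, vectorOracle]

/-- A run of a list of steps of the given algorithm on one tensor factor. -/
theorem Reach.simSteps {w : ℕ} {R : Type*} [Fintype R] (e : Fin n ≃ Fin k × Fin d)
    (j₀ : Fin d) (l₀ : Fin n)
    {A : Matrix (Fin d) (Fin n) F → (Fin n → F) → (Fin d × Fin n × F) → (Fin n × F) →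
      (Fin d → F) → (Fin n → F) × R → ℂ}
    (hA : ∀ M v m u o r, A M v m u o r ≠ 0 → m = (j₀, l₀, 0) ∧ r.1 = v)
    (l : List (QueryKind × Matrix.unitaryGroup (QBasis F n n w) ℂ)) :
    ∀ {a : ℕ} {χ : Matrix (Fin d) (Fin n) F → (Fin n → F) → Seed F n k × QBasis F n n w → ℂ},
    (Reach a b fun M v
        (s : RegBasis F d n ((Seed F n k × QBasis F n n w) × (Fin n → F) × R)) =>
      A M v s.1 s.2.1 s.2.2.1 s.2.2.2.2 * χ M v s.2.2.2.1) →
    Reach (a + 2 * l.countP fun s => s.1.isMat) b fun M v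
        (s : RegBasis F d n ((Seed F n k × QBasis F n n w) × (Fin n → F) × R)) =>
      A M v s.1 s.2.1 s.2.2.1 s.2.2.2.2 *
        l.foldl (fun ψ t => (t.2 : Matrix _ _ ℂ) *ᵥ t.1.apply (Seed.plant e s.2.2.2.1.1 M) v ψ)
          (fun x => χ M v (s.2.2.2.1.1, x)) s.2.2.2.1.2 := by
  induction l with
  | nil => intro a χ h; simpa using h
  | cons t l ih =>
    intro a χ h
    have h1 := (h.simQuery e j₀ l₀ hA t.1).localUnitary t.2.2
    have h2 := ih (a := a + if t.1.isMat then 2 else 0) (χ := fun M v y =>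
      ((t.2 : Matrix _ _ ℂ) *ᵥ
        t.1.apply (Seed.plant e y.1 M) v fun x => χ M v (y.1, x)) y.2)
      (h1.congr fun M v m u o x => by
        simp only [Matrix.mulVec, dotProduct, Finset.mul_sum]
        exact Finset.sum_congr rfl fun y _ => by ring)
    convert h2 using 1
    · rw [List.countP_cons]
      split_ifs <;> ring
    · rfl

/-- A run of the whole algorithm on one tensor factor, on the matrix planted by the seed held in
that factor. -/
theorem Reach.simRun {R : Type*} [Fintype R] (ALG : QueryAlgorithm F n n)
    (e : Fin n ≃ Fin k × Fin d) (j₀ : Fin d) (l₀ : Fin n) (γ : ℂ)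
    {A : Matrix (Fin d) (Fin n) F → (Fin n → F) → (Fin d × Fin n × F) → (Fin n × F) →
      (Fin d → F) → (Fin n → F) × R → ℂ}
    (hA : ∀ M v m u o r, A M v m u o r ≠ 0 → m = (j₀, l₀, 0) ∧ r.1 = v)
    (h : Reach a b fun M v
        (s : RegBasis F d n ((Seed F n k × QBasis F n n ALG.work) × (Fin n → F) × R)) =>
      A M v s.1 s.2.1 s.2.2.1 s.2.2.2.2 *
        (γ * ((ALG.initial : Matrix _ _ ℂ) *ᵥ Pi.single ALG.start 1) s.2.2.2.1.2)) :
    Reach (a + 2 * ALG.matrixQueries) b fun M v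
        (s : RegBasis F d n ((Seed F n k × QBasis F n n ALG.work) × (Fin n → F) × R)) =>
      A M v s.1 s.2.1 s.2.2.1 s.2.2.2.2 *
        (γ * ALG.finalState (Seed.plant e s.2.2.2.1.1 M) v s.2.2.2.1.2) := by
  have h1 := Reach.simSteps e j₀ l₀ (A := fun M v m u o r => A M v m u o r * γ)
    (fun M v m u o r h0 => hA M v m u o r (left_ne_zero_of_mul h0)) ALG.steps
    (χ := fun _ _ y => ((ALG.initial : Matrix _ _ ℂ) *ᵥ Pi.single ALG.start 1) y.2)
    (h.congr fun M v m u o x => (mul_assoc _ _ _).symm)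
  exact h1.congr fun M v m u o x => mul_assoc _ _ _

end Simulation

/-! ### Independent trials in superposition -/

section Trials

variable {F : Type*} [Field F] [Fintype F] [DecidableEq F] {n k d a b : ℕ}

/-- Two queries per entry copy the vector into the workspace: an entry is computed into the query
register, added to the workspace, and erased. The formula is exact on all basis states; when the
register is idle, in the state `(l₀, 0)`, the quantity subtracted is `v` on `S`. -/
theorem Reach.storeVector {R : Type*} [Fintype R] (l₀ : Fin n)
    {ψ : Matrix (Fin d) (Fin n) F → (Fin n → F) → RegBasis F d n ((Fin n → F) × R) → ℂ}
    (h : Reach a b ψ) (S : Finset (Fin n)) :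
    Reach a (b + 2 * S.card) fun M v (s : RegBasis F d n ((Fin n → F) × R)) =>
      ψ M v (s.1, s.2.1, s.2.2.1, s.2.2.2.1 - (fun i => if i ∈ S then
        s.2.1.2 + v (Equiv.swap l₀ i s.2.1.1) else 0), s.2.2.2.2) := by
  classical
  induction S using Finset.induction_on with
  | empty => exact h.congr fun M v m u o x => by simp [← Pi.zero_def]
  | insert i S hi ih =>
    let f : Equiv.Perm (Fin n × F) := (Equiv.swap l₀ i).prodCongr (Equiv.refl F)
    let D : (Fin d × Fin n × F) → (Fin n × F) → Equiv.Perm ((Fin n → F) × R) := fun _ u =>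
      { toFun := fun y => (y.1 + Pi.single i u.2, y.2)
        invFun := fun y => (y.1 - Pi.single i u.2, y.2)
        left_inv := fun y => by simp
        right_inv := fun y => by simp }
    have h1 := ((((ih.permVec f).vec).ctrlWork D).vecAdj).permVec f.symm
    rw [Finset.card_insert_of_notMem hi, show b + 2 * (S.card + 1) = b + 2 * S.card + 1 + 1 by ring]
    refine h1.congr fun M v m u o x => ?_
    simp only [f, D, Equiv.prodCongr_symm, Equiv.prodCongr_apply, Prod.map,
      Equiv.coe_fn_symm_mk, Equiv.symm_swap, Equiv.swap_apply_self, Equiv.refl_apply,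
      Equiv.refl_symm, add_sub_cancel_right]
    congr 5
    funext j
    by_cases hj : j = i
    · subst hj
      simp [hi]
    · simp [hj]

/-- The (real) amplitude of each seed in the uniform superposition. -/
noncomputable def seedAmp (F : Type*) [Fintype F] (n k : ℕ) : ℝ :=
  (√(Fintype.card (Seed F n k) : ℝ))⁻¹

theorem Matrix.sum_norm_sq_mulVec {n : Type*} [Fintype n] [DecidableEq n] {U : Matrix n n ℂ}
    (hU : U ∈ Matrix.unitaryGroup n ℂ) (φ : n → ℂ) :
    ∑ i, ‖(U *ᵥ φ) i‖ ^ 2 = ∑ i, ‖φ i‖ ^ 2 := by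
  have key : ∀ χ : n → ℂ, ((∑ i, ‖χ i‖ ^ 2 : ℝ) : ℂ) = star χ ⬝ᵥ χ := fun χ => by
    simp [dotProduct, Complex.conj_mul']
  have h := key (U *ᵥ φ)
  rw [Matrix.star_mulVec, Matrix.dotProduct_mulVec, Matrix.vecMul_vecMul,
    ← Matrix.star_eq_conjTranspose, (Matrix.mem_unitaryGroup_iff').1 hU, Matrix.vecMul_one,
    ← key] at h
  exact_mod_cast h

theorem sum_norm_sq_single {n : Type*} [Fintype n] [DecidableEq n] (i : n) :
    ∑ j, ‖(Pi.single i 1 : n → ℂ) j‖ ^ 2 = 1 := by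
  rw [Finset.sum_eq_single i] <;> simp +contextual

theorem QueryAlgorithm.sum_norm_sq_finalState {r c : ℕ} (A : QueryAlgorithm F r c)
    (M : Matrix (Fin r) (Fin c) F) (v : Fin c → F) : ∑ s, ‖A.finalState M v s‖ ^ 2 = 1 := by
  have key : ∀ (l : List (QueryKind × Matrix.unitaryGroup (QBasis F r c A.work) ℂ))
      (φ : QBasis F r c A.work → ℂ),
      ∑ s, ‖l.foldl (fun ψ s => (s.2 : Matrix _ _ ℂ) *ᵥ s.1.apply M v ψ) φ s‖ ^ 2 =
        ∑ s, ‖φ s‖ ^ 2 := by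
    intro l
    induction l with
    | nil => intro φ; rfl
    | cons t l ih =>
      intro φ
      rw [List.foldl_cons, ih, Matrix.sum_norm_sq_mulVec t.2.2]
      exact (t.1.perm M v).symm.sum_comp fun s => ‖φ s‖ ^ 2
  rw [finalState, key, Matrix.sum_norm_sq_mulVec A.initial.2, sum_norm_sq_single]

/-- A sum supported on the graph of a function of the last coordinate. -/
theorem sum_ite_basis {A B C D E : Type*} [Fintype A] [Fintype B] [Fintype C] [Fintype D]
    [Fintype E] [DecidableEq A] [DecidableEq B] [DecidableEq C] [DecidableEq D]
    (a : A) (b : B) (c : E → C) (z : D) (g : A × B × C × D × E → ℝ) :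
    (∑ s : A × B × C × D × E, if s.1 = a ∧ s.2.1 = b ∧ s.2.2.1 = c s.2.2.2.2 ∧ s.2.2.2.1 = z
      then g s else 0) = ∑ y, g (a, b, c y, z, y) := by
  symm
  refine Finset.sum_of_injOn (fun y => (a, b, c y, z, y)) ?_ ?_ ?_ ?_
  · intro x _ y _ h
    simpa using congrArg (fun s => s.2.2.2.2) h
  · intro x _
    simp
  · rintro ⟨a', b', c', z', y⟩ _ h
    rw [if_neg]
    rintro ⟨rfl, rfl, h1, rfl⟩
    exact h ⟨y, by simp, by simp_all⟩
  · intro y _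
    simp

/-- A family of unit vectors in uniform superposition over the seeds is a unit vector. -/
theorem sum_norm_sq_seedAmp {F : Type*} [Fintype F] [Nonempty F] {X : Type*} [Fintype X]
    {φ : Seed F n k → X → ℂ}
    (hφ : ∀ ω, ∑ x, ‖φ ω x‖ ^ 2 = 1) :
    ∑ y : Seed F n k × X, ‖(seedAmp F n k : ℂ) * φ y.1 y.2‖ ^ 2 = 1 := by
  have hc : (0 : ℝ) < Fintype.card (Seed F n k) := by exact_mod_cast Fintype.card_pos
  rw [Fintype.sum_prod_type]
  simp only [norm_mul, mul_pow, ← Finset.mul_sum, hφ, Complex.norm_real, Real.norm_eq_abs, sq_abs,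
    seedAmp, inv_pow, Real.sq_sqrt hc.le]
  rw [Finset.sum_const, Finset.card_univ, nsmul_eq_mul, mul_one, inv_mul_cancel₀ hc.ne']

/-- The state of one trial: a uniform superposition of seeds, and the final state of the
algorithm on the matrix planted by the seed. -/
noncomputable def trialState (ALG : QueryAlgorithm F n n) (e : Fin n ≃ Fin k × Fin d)
    (M : Matrix (Fin d) (Fin n) F) (v : Fin n → F) (y : Seed F n k × QBasis F n n ALG.work) : ℂ :=
  seedAmp F n k * ALG.finalState (y.1.plant e M) v y.2

/-- The state of a trial before its algorithm is run. -/
noncomputable def trialInit (ALG : QueryAlgorithm F n n) (k : ℕ)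
    (y : Seed F n k × QBasis F n n ALG.work) : ℂ :=
  seedAmp F n k * ((ALG.initial : Matrix _ _ ℂ) *ᵥ Pi.single ALG.start 1) y.2

/-- The basis state in which all query and output registers are idle and the workspace
stores `v`. -/
def idle (j₀ : Fin d) (l₀ : Fin n) (v : Fin n → F) (m : Fin d × Fin n × F) (u : Fin n × F)
    (o : Fin d → F) (z : Fin n → F) : ℂ :=
  if m = (j₀, l₀, 0) ∧ u = (l₀, 0) ∧ o = 0 ∧ z = v then 1 else 0

/-- Trials in the set `S` are run, one after the other, next to the idle registers. -/
theorem Reach.runTrials {T : ℕ} (ALG : QueryAlgorithm F n n) (e : Fin n ≃ Fin k × Fin d)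
    (j₀ : Fin d) (l₀ : Fin n)
    (h : Reach a b fun (_ : Matrix (Fin d) (Fin n) F) v
        (s : RegBasis F d n ((Fin n → F) × (Fin T → Seed F n k × QBasis F n n ALG.work))) =>
      idle j₀ l₀ v s.1 s.2.1 s.2.2.1 s.2.2.2.1 * ∏ t, trialInit ALG k (s.2.2.2.2 t))
    (S : Finset (Fin T)) :
    Reach (a + S.card * (2 * ALG.matrixQueries)) b fun M v
        (s : RegBasis F d n ((Fin n → F) × (Fin T → Seed F n k × QBasis F n n ALG.work))) =>
      idle j₀ l₀ v s.1 s.2.1 s.2.2.1 s.2.2.2.1 *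
        ∏ t, if t ∈ S then trialState ALG e M v (s.2.2.2.2 t)
          else trialInit ALG k (s.2.2.2.2 t) := by
  classical
  induction S using Finset.induction_on with
  | empty => simpa using h
  | insert t S ht ih =>
    let G : (Seed F n k × QBasis F n n ALG.work) × (Fin n → F) ×
        ({j // j ≠ t} → Seed F n k × QBasis F n n ALG.work) ≃
        (Fin n → F) × (Fin T → Seed F n k × QBasis F n n ALG.work) :=
      { toFun := fun p => (p.2.1, (Equiv.funSplitAt t _).symm (p.1, p.2.2))
        invFun := fun p => ((Equiv.funSplitAt t _ p.2).1, p.1, (Equiv.funSplitAt t _ p.2).2)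
        left_inv := fun p => by simp
        right_inv := fun p => Prod.ext rfl ((Equiv.funSplitAt t _).symm_apply_apply _) }
    have hne : ∀ j : {j // j ≠ t}, (j.1 = t) = False := fun j => eq_false j.2
    have hprod : ∀ (S' : Finset (Fin T)) (M : Matrix (Fin d) (Fin n) F) (v : Fin n → F)
        (x : Fin T → Seed F n k × QBasis F n n ALG.work),
        (∏ j, if j ∈ S' then trialState ALG e M v (x j) else trialInit ALG k (x j)) =
        (if t ∈ S' then trialState ALG e M v (x t) else trialInit ALG k (x t)) *
          ∏ j : {j // j ≠ t}, if j.1 ∈ S' then trialState ALG e M v (x j)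
            else trialInit ALG k (x j) := fun S' M v x =>
      Fintype.prod_eq_mul_prod_subtype_ne _ t
    have h1 := ((Reach.simRun ALG e j₀ l₀ (seedAmp F n k : ℂ) (a := a + S.card *
      (2 * ALG.matrixQueries)) (b := b) (R := {j // j ≠ t} → Seed F n k × QBasis F n n ALG.work)
      (A := fun M v m u o r => idle j₀ l₀ v m u o r.1 * ∏ j : {j // j ≠ t},
        if j.1 ∈ S then trialState ALG e M v (r.2 j) else trialInit ALG k (r.2 j))
      (fun M v m u o r h0 => by
        have h2 := left_ne_zero_of_mul h0
        simp only [idle, ne_eq, ite_eq_right_iff, one_ne_zero, imp_false, not_not] at h2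
        exact ⟨h2.1, h2.2.2.2⟩)
      ((ih.relabel G).congr fun M v m u o x => by
        simp only [hprod]
        simp only [G, ht, hne, if_false, Equiv.coe_fn_mk, Equiv.funSplitAt_symm_apply, dite_true,
          dite_false, trialInit]
        ring)).relabel G.symm)
    rw [Finset.card_insert_of_notMem ht, show a + (S.card + 1) * (2 * ALG.matrixQueries) =
      a + S.card * (2 * ALG.matrixQueries) + 2 * ALG.matrixQueries by ring]
    refine h1.congr fun M v m u o x => ?_
    simp only [hprod]
    simp only [G, hne, Finset.mem_insert, true_or, false_or, if_true, Equiv.coe_fn_symm_mk,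
      Equiv.funSplitAt_apply]
    rw [mul_comm (trialState ALG e M v (x.2 t))]
    exact mul_assoc _ _ _

/-- The product of `T` independent trials is reached with the query counts of `T` runs. -/
theorem reach_trials (T : ℕ) (ALG : QueryAlgorithm F n n) (e : Fin n ≃ Fin k × Fin d)
    (j₀ : Fin d) (l₀ : Fin n) :
    Reach (T * (2 * ALG.matrixQueries)) (2 * n) fun M v
        (s : RegBasis F d n ((Fin n → F) × (Fin T → Seed F n k × QBasis F n n ALG.work))) =>
      idle j₀ l₀ v s.1 s.2.1 s.2.2.1 s.2.2.2.1 *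
        ∏ t, trialState ALG e M v (s.2.2.2.2 t) := by
  have hinit : ∑ y, ‖trialInit ALG k y‖ ^ 2 = 1 := by
    have h0 : ∑ x, ‖((ALG.initial : Matrix (QBasis F n n ALG.work) (QBasis F n n ALG.work) ℂ) *ᵥ
        Pi.single ALG.start 1) x‖ ^ 2 = 1 := by
      rw [Matrix.sum_norm_sq_mulVec ALG.initial.2, sum_norm_sq_single]
    have h1 := sum_norm_sq_seedAmp (F := F) (n := n) (k := k) fun _ => h0
    simpa only [trialInit] using h1
  let φ : RegBasis F d n ((Fin n → F) × (Fin T → Seed F n k × QBasis F n n ALG.work)) → ℂ :=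
    fun s => idle j₀ l₀ 0 s.1 s.2.1 s.2.2.1 s.2.2.2.1 * ∏ t, trialInit ALG k (s.2.2.2.2 t)
  have hφ : ∑ s, ‖φ s‖ ^ 2 = 1 := by
    rw [← one_pow T, ← hinit, Fintype.sum_pow, ← sum_ite_basis (j₀, l₀, (0 : F)) (l₀, (0 : F))
      (fun _ => (0 : Fin d → F)) (0 : Fin n → F)
      (fun s => ∏ t : Fin T, ‖trialInit ALG k ((s.2.2.2.2 : Fin T → _) t)‖ ^ 2)]
    refine Finset.sum_congr rfl fun s _ => ?_
    simp only [φ, idle]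
    split_ifs <;> simp [Finset.prod_pow]
  have h1 := (Reach.init hφ).storeVector l₀ Finset.univ
  have h2 := Reach.runTrials (T := T) ALG e j₀ l₀ (h1.congr
    (ψ' := fun _ v s => idle j₀ l₀ v s.1 s.2.1 s.2.2.1 s.2.2.2.1 *
      ∏ t, trialInit ALG k (s.2.2.2.2 t)) fun M v m u o x => by
    simp only [φ, idle, Finset.mem_univ, if_true]
    congr 2
    refine propext (and_congr_right fun _ => and_congr_right ?_)
    rintro rfl
    simp [sub_eq_zero]) Finset.univ
  simpa using h2

end Trials

/-! ### Probability estimates -/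

section Probability

/-- The exponential weights `3/2` on `W` and `2/3` off `W` dominate the indicator of the event that
a random set of blocks contains `W` and has at most `|W|` further elements. -/
theorem card_planted_sets_le {k : ℕ} (W : Finset (Fin k)) :
    (∑ S : Fin k → Bool, if (∀ i ∈ W, S i = true) ∧
      (Finset.univ.filter fun i => S i = true ∧ i ∉ W).card ≤ W.card then (1 : ℝ) else 0) ≤
      (5 / 3) ^ k := by
  let wt : Fin k → Bool → ℝ := fun i b =>
    if i ∈ W then (if b then 3 / 2 else 0) else (if b then 2 / 3 else 1)
  have hwt : ∀ i b, 0 ≤ wt i b := fun i b => by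
    simp only [wt]
    split_ifs <;> norm_num
  calc _ ≤ ∑ S : Fin k → Bool, ∏ i, wt i (S i) := by
        refine Finset.sum_le_sum fun S _ => ?_
        split_ifs with h
        · have h1 : ∀ i, wt i (S i) = (if i ∈ W then 3 / 2 else 1) *
              (if S i = true ∧ i ∉ W then 2 / 3 else 1) := fun i => by
            by_cases hi : i ∈ W
            · simp [wt, hi, h.1 i hi]
            · simp [wt, hi]
          simp only [h1, Finset.prod_mul_distrib, Finset.prod_ite, Finset.prod_const,
            one_pow, mul_one, Finset.filter_univ_mem]
          calc (1 : ℝ) = (3 / 2) ^ W.card * (2 / 3) ^ W.card := by rw [← mul_pow]; norm_num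
            _ ≤ _ := by
              exact mul_le_mul_of_nonneg_left
                (pow_le_pow_of_le_one (by norm_num) (by norm_num) h.2) (by positivity)
        · exact Finset.prod_nonneg fun i _ => hwt i _
    _ = ∏ i, ∑ b, wt i b := by
        rw [Finset.prod_univ_sum, Fintype.piFinset_univ]
    _ ≤ ∏ _i : Fin k, (5 / 3 : ℝ) := by
        refine Finset.prod_le_prod (fun i _ => Finset.sum_nonneg fun b _ => hwt i b) fun i _ => ?_
        by_cases hi : i ∈ W
        · simp [wt, hi]
          norm_num
        · simp [wt, hi]
          norm_num
    _ = (5 / 3) ^ k := by rw [Finset.prod_const, Finset.card_univ, Fintype.card_fin]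

/-- If an event `B` of `T` independent trials holds as soon as no trial is bad and some trial is
good, then it holds with probability at least `1 - T β - (1 - γ) ^ T`. -/
theorem le_sum_prod_trials {Y : Type*} [Fintype Y] {p : Y → ℝ} (hp : ∀ y, 0 ≤ p y)
    (hp1 : ∑ y, p y = 1) {bad good : Y → Prop} [DecidablePred bad] [DecidablePred good]
    {β γ : ℝ} (hβ : (∑ y, if bad y then p y else 0) ≤ β)
    (hγ : γ ≤ ∑ y, if good y then p y else 0) {T : ℕ}
    {B : (Fin T → Y) → Prop} [DecidablePred B]
    (hB : ∀ y, (∀ t, ¬ bad (y t)) → (∃ t, good (y t)) → B y) :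
    1 - T * β - (1 - γ) ^ T ≤ ∑ y, if B y then ∏ t, p (y t) else 0 := by
  have hnot : ∀ (E : Y → Prop) [DecidablePred E],
      (∑ y, if E y then 0 else p y) = 1 - ∑ y, if E y then p y else 0 := by
    intro E _
    rw [← hp1, ← Finset.sum_sub_distrib]
    exact Finset.sum_congr rfl fun y _ => by split_ifs <;> simp
  have hle : ∀ (E : Y → Prop) [DecidablePred E], (∑ y, if E y then p y else 0) ≤ 1 := by
    intro E _
    rw [← hp1]
    exact Finset.sum_le_sum fun y _ => by split_ifs <;> simp [hp]
  have hpt : (∑ y : Fin T → Y, ((∏ t, if bad (y t) then 0 else p (y t)) -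
      ∏ t, if good (y t) then 0 else p (y t))) ≤ ∑ y, if B y then ∏ t, p (y t) else 0 := by
    refine Finset.sum_le_sum fun y _ => ?_
    have hg0 : 0 ≤ ∏ t, if good (y t) then 0 else p (y t) :=
      Finset.prod_nonneg fun t _ => by split_ifs <;> simp [hp]
    have hB0 : 0 ≤ if B y then ∏ t, p (y t) else 0 := by
      split_ifs
      · exact Finset.prod_nonneg fun t _ => hp _
      · exact le_rfl
    by_cases hb : ∃ t, bad (y t)
    · obtain ⟨t, ht⟩ := hb
      rw [Finset.prod_eq_zero (f := fun t => if bad (y t) then 0 else p (y t))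
        (Finset.mem_univ t) (if_pos ht)]
      linarith
    push Not at hb
    simp only [hb, if_false]
    by_cases hg : ∃ t, good (y t)
    · rw [if_pos (hB y hb hg)]
      linarith
    · push Not at hg
      simpa only [hg, if_false, sub_self] using hB0
  rw [Finset.sum_sub_distrib, ← Fintype.sum_pow (fun y => if bad y then 0 else p y),
    ← Fintype.sum_pow (fun y => if good y then 0 else p y), hnot, hnot] at hpt
  have h1 := one_add_mul_le_pow (a := -∑ y, if bad y then p y else 0)
    (by linarith [hle bad]) T
  have h2 : (1 - ∑ y, if good y then p y else 0) ^ T ≤ (1 - γ) ^ T :=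
    pow_le_pow_left₀ (by linarith [hle good]) (by linarith) T
  have h3 : (T : ℝ) * (∑ y, if bad y then p y else 0) ≤ T * β :=
    mul_le_mul_of_nonneg_left hβ (Nat.cast_nonneg T)
  rw [← sub_eq_add_neg] at h1
  linarith

end Probability

/-! ### Decoding the outcomes of the trials -/

section Decoding

variable {F : Type*} [Field F] {n k d : ℕ}

/-- For every fixed input matrix, the planted matrix is uniform and independent of the set of
planted blocks. -/
theorem Seed.sum_plant [Fintype F] (e : Fin n ≃ Fin k × Fin d) (M : Matrix (Fin d) (Fin n) F)
    (g : Matrix (Fin n) (Fin n) F → (Fin k → Bool) → ℝ) :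
    ∑ ω : Seed F n k, g (ω.plant e M) ω.2 = ∑ N, ∑ S, g N S := by
  rw [Fintype.sum_prod_type_right, Finset.sum_comm (s := Finset.univ (α := Matrix _ _ F))]
  refine Finset.sum_congr rfl fun S _ => ?_
  exact Fintype.sum_equiv (Matrix.of.trans (Equiv.addRight
    (Matrix.of fun j l => if S (e j).1 then M (e j).2 l else 0))) _ _ fun R => rfl

variable {e : Fin n ≃ Fin k × Fin d} {ω : Seed F n k} {M : Matrix (Fin d) (Fin n) F}
  {v z : Fin n → F}

theorem Seed.plant_mulVec (i : Fin k) (r : Fin d) :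
    (ω.plant e M *ᵥ v) (e.symm (i, r)) =
      (Matrix.of ω.1 *ᵥ v) (e.symm (i, r)) + if ω.2 i then (M *ᵥ v) r else 0 := by
  simp only [Matrix.mulVec, dotProduct, Seed.plant, Matrix.of_apply, Equiv.apply_symm_apply,
    add_mul, Finset.sum_add_distrib]
  split_ifs <;> simp

variable [DecidableEq F]

/-- The value that a trial proposes for the block `i`: the output of the algorithm, without the
contribution of the mask. -/
def Seed.unmask (e : Fin n ≃ Fin k × Fin d) (ω : Seed F n k) (v z : Fin n → F) (i : Fin k) :
    Fin d → F :=
  fun r => z (e.symm (i, r)) - (Matrix.of ω.1 *ᵥ v) (e.symm (i, r))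

/-- A trial accepts `u` if the algorithm was right on all blocks without a copy of the input
matrix, and a strict majority of the blocks with a copy propose `u`. -/
def Seed.Accepts (e : Fin n ≃ Fin k × Fin d) (ω : Seed F n k) (v z : Fin n → F)
    (u : Fin d → F) : Prop :=
  (∀ i, ω.2 i = false → ω.unmask e v z i = 0) ∧
    (Finset.univ.filter fun i => ω.2 i = true ∧ ω.unmask e v z i ≠ u).card <
      (Finset.univ.filter fun i => ω.2 i = true ∧ ω.unmask e v z i = u).card

/-- The blocks on which two vectors differ. -/
def diffBlocks (e : Fin n ≃ Fin k × Fin d) (z z' : Fin n → F) : Finset (Fin k) :=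
  Finset.univ.filter fun i => ∃ r, z (e.symm (i, r)) ≠ z' (e.symm (i, r))

/-- A set of planted blocks is bad for the output `z`, whose correct value is `z'`, if it covers
all wrong blocks and does not contain more correct blocks than wrong ones. -/
def BadSet (e : Fin n ≃ Fin k × Fin d) (z z' : Fin n → F) (S : Fin k → Bool) : Prop :=
  (∀ i ∈ diffBlocks e z z', S i = true) ∧
    (Finset.univ.filter fun i => S i = true ∧ i ∉ diffBlocks e z z').card ≤
      (diffBlocks e z z').card

theorem Seed.mem_diffBlocks {i : Fin k} :
    i ∈ diffBlocks e z (ω.plant e M *ᵥ v) ↔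
      ω.unmask e v z i ≠ if ω.2 i then M *ᵥ v else 0 := by
  simp only [diffBlocks, Finset.mem_filter, Finset.mem_univ, true_and, ne_eq, funext_iff,
    Seed.unmask, Seed.plant_mulVec, not_forall, sub_eq_iff_eq_add']
  refine exists_congr fun r => ?_
  split_ifs <;> simp

theorem Seed.Accepts.eq {u : Fin d → F} (h : ω.Accepts e v z u)
    (hbad : ¬ BadSet e z (ω.plant e M *ᵥ v) ω.2) : u = M *ᵥ v := by
  by_contra hu
  refine hbad ⟨fun i hi => ?_, ?_⟩
  · by_contra hS
    rw [Bool.not_eq_true] at hS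
    rw [Seed.mem_diffBlocks, hS] at hi
    exact hi (h.1 i hS)
  · refine (Finset.card_le_card ?_).trans (h.2.le.trans (Finset.card_le_card ?_))
    · intro i
      simp only [Finset.mem_filter, Finset.mem_univ, true_and, Seed.mem_diffBlocks, not_not]
      rintro ⟨hS, hi⟩
      rw [if_pos hS] at hi
      exact ⟨hS, fun h' => hu (h'.symm.trans hi)⟩
    · intro i
      simp only [Finset.mem_filter, Finset.mem_univ, true_and, Seed.mem_diffBlocks]
      rintro ⟨hS, hi⟩
      rwa [if_pos hS, hi]

theorem Seed.accepts_of_eq (hz : z = ω.plant e M *ᵥ v)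
    (hbad : ¬ BadSet e z (ω.plant e M *ᵥ v) ω.2) : ω.Accepts e v z (M *ᵥ v) := by
  have hW : diffBlocks e z (ω.plant e M *ᵥ v) = ∅ := by simp [diffBlocks, hz]
  have hi : ∀ i, ω.unmask e v z i = if ω.2 i then M *ᵥ v else 0 := fun i => by
    by_contra h
    have h1 := Seed.mem_diffBlocks.2 h
    simp [hW] at h1
  refine ⟨fun i h => by simp [hi, h], ?_⟩
  simp only [BadSet, hW, Finset.notMem_empty, not_false_eq_true, and_true, IsEmpty.forall_iff,
    implies_true, true_and, Finset.card_empty, not_le] at hbad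
  refine (le_of_eq ?_).trans_lt (hbad.trans_le (Finset.card_le_card ?_))
  · rw [Finset.card_eq_zero, Finset.filter_eq_empty_iff]
    rintro i - ⟨hS, h⟩
    exact h (by rw [hi, if_pos hS])
  · intro i
    simp only [Finset.mem_filter, Finset.mem_univ, true_and]
    exact fun hS => ⟨hS, by rw [hi, if_pos hS]⟩

open Classical in
/-- The value output after all trials: one that some trial accepts. -/
noncomputable def decode {X : Type*} {T : ℕ} (out : X → Fin n → F) (e : Fin n ≃ Fin k × Fin d)
    (v : Fin n → F) (y : Fin T → Seed F n k × X) : Fin d → F :=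
  if h : ∃ u t, (y t).1.Accepts e v (out (y t).2) u then h.choose else 0

theorem decode_eq {X : Type*} {T : ℕ} {out : X → Fin n → F} {y : Fin T → Seed F n k × X}
    (hbad : ∀ t, ¬ BadSet e (out (y t).2) ((y t).1.plant e M *ᵥ v) (y t).1.2)
    (hgood : ∃ t, out (y t).2 = (y t).1.plant e M *ᵥ v) : decode out e v y = M *ᵥ v := by
  obtain ⟨t, ht⟩ := hgood
  have h : ∃ u t, (y t).1.Accepts e v (out (y t).2) u :=
    ⟨_, t, Seed.accepts_of_eq ht (hbad t)⟩
  rw [decode, dif_pos h]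
  obtain ⟨t', ht'⟩ := h.choose_spec
  exact ht'.eq (hbad t')

end Decoding

/-! ### Outcome probabilities and amplification -/

section TrialProbability

variable {F : Type*} [Field F] [Fintype F] [DecidableEq F] {n k d : ℕ}

/-- Expectations over the outcome of one trial, as averages over a uniform matrix and a uniform set
of blocks. -/
theorem sum_trialState (ALG : QueryAlgorithm F n n) (e : Fin n ≃ Fin k × Fin d)
    (M : Matrix (Fin d) (Fin n) F) (v : Fin n → F)
    (g : Matrix (Fin n) (Fin n) F → (Fin k → Bool) → QBasis F n n ALG.work → ℝ) :
    ∑ y, ‖trialState ALG e M v y‖ ^ 2 * g (y.1.plant e M) y.1.2 y.2 =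
      (Fintype.card (Matrix (Fin n) (Fin n) F) : ℝ)⁻¹ * ((2 : ℝ) ^ k)⁻¹ *
        ∑ N, ∑ x, ‖ALG.finalState N v x‖ ^ 2 * ∑ S, g N S x := by
  have hcard : seedAmp F n k ^ 2 =
      (Fintype.card (Matrix (Fin n) (Fin n) F) : ℝ)⁻¹ * ((2 : ℝ) ^ k)⁻¹ := by
    have h1 : Fintype.card (Seed F n k) = Fintype.card (Matrix (Fin n) (Fin n) F) * 2 ^ k := by
      rw [Fintype.card_prod, Fintype.card_fun (α := Fin k), Fintype.card_bool, Fintype.card_fin]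
      rfl
    rw [seedAmp, inv_pow, Real.sq_sqrt (Nat.cast_nonneg _), h1]
    push_cast
    rw [mul_inv]
  have h2 : ∀ y : Seed F n k × QBasis F n n ALG.work,
      ‖trialState ALG e M v y‖ ^ 2 * g (y.1.plant e M) y.1.2 y.2 =
      seedAmp F n k ^ 2 * (‖ALG.finalState (y.1.plant e M) v y.2‖ ^ 2 *
        g (y.1.plant e M) y.1.2 y.2) := fun y => by
    rw [trialState, norm_mul, mul_pow, Complex.norm_real, Real.norm_eq_abs, sq_abs, mul_assoc]
  simp only [h2, ← Finset.mul_sum, hcard]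
  congr 1
  rw [Fintype.sum_prod_type, Seed.sum_plant e M fun N S =>
    ∑ x, ‖ALG.finalState N v x‖ ^ 2 * g N S x]
  refine Finset.sum_congr rfl fun N _ => ?_
  rw [Finset.sum_comm]
  simp only [Finset.mul_sum]

theorem sum_norm_sq_trialState (ALG : QueryAlgorithm F n n) (e : Fin n ≃ Fin k × Fin d)
    (M : Matrix (Fin d) (Fin n) F) (v : Fin n → F) : ∑ y, ‖trialState ALG e M v y‖ ^ 2 = 1 :=
  sum_norm_sq_seedAmp (φ := fun ω => ALG.finalState (ω.plant e M) v)
    fun _ => ALG.sum_norm_sq_finalState _ v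

open Classical in
/-- A set of blocks that is uniform and independent of the output is rarely bad for it. -/
theorem prob_badSet_le (ALG : QueryAlgorithm F n n) (e : Fin n ≃ Fin k × Fin d)
    (M : Matrix (Fin d) (Fin n) F) (v : Fin n → F) :
    (∑ y, if BadSet e y.2.2.2.1 (y.1.plant e M *ᵥ v) y.1.2 then ‖trialState ALG e M v y‖ ^ 2
      else 0) ≤ (5 / 6) ^ k := by
  have h := sum_trialState ALG e M v
    fun N S x => if BadSet e x.2.2.1 (N *ᵥ v) S then 1 else 0
  simp only [mul_ite, mul_one, mul_zero] at h
  rw [h]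
  have h1 : ∀ N : Matrix (Fin n) (Fin n) F, ∑ x, ‖ALG.finalState N v x‖ ^ 2 *
      (∑ S, if BadSet e x.2.2.1 (N *ᵥ v) S then (1 : ℝ) else 0) ≤ (5 / 3) ^ k := fun N => by
    calc _ ≤ ∑ x, ‖ALG.finalState N v x‖ ^ 2 * (5 / 3 : ℝ) ^ k := by
          refine Finset.sum_le_sum fun x _ => mul_le_mul_of_nonneg_left ?_ (by positivity)
          refine (Finset.sum_congr rfl fun S _ => ?_).le.trans
            (card_planted_sets_le (diffBlocks e x.2.2.1 (N *ᵥ v)))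
          exact if_congr Iff.rfl rfl rfl
      _ = (5 / 3) ^ k := by rw [← Finset.sum_mul, ALG.sum_norm_sq_finalState, one_mul]
  have hc : (0 : ℝ) < Fintype.card (Matrix (Fin n) (Fin n) F) := by
    exact_mod_cast Fintype.card_pos
  calc _ ≤ (Fintype.card (Matrix (Fin n) (Fin n) F) : ℝ)⁻¹ * ((2 : ℝ) ^ k)⁻¹ *
        ∑ _N : Matrix (Fin n) (Fin n) F, (5 / 3 : ℝ) ^ k :=
      mul_le_mul_of_nonneg_left (Finset.sum_le_sum fun N _ => h1 N) (by positivity)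
    _ = (5 / 6) ^ k := by
      rw [Finset.sum_const, Finset.card_univ, nsmul_eq_mul, show (5 / 6 : ℝ) = 2⁻¹ * (5 / 3) by
        norm_num, mul_pow, inv_pow]
      field_simp

open Classical in
theorem prob_correct_eq (ALG : QueryAlgorithm F n n) (e : Fin n ≃ Fin k × Fin d)
    (M : Matrix (Fin d) (Fin n) F) (v : Fin n → F) :
    (∑ y, if y.2.2.2.1 = y.1.plant e M *ᵥ v then ‖trialState ALG e M v y‖ ^ 2 else 0) =
      ALG.vectorSuccess v := by
  have h := sum_trialState ALG e M v
    fun N _ x => if x.2.2.1 = N *ᵥ v then 1 else 0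
  simp only [mul_ite, mul_one, mul_zero] at h
  rw [h]
  have h1 : ∀ N : Matrix (Fin n) (Fin n) F, ∑ x, ‖ALG.finalState N v x‖ ^ 2 *
      (∑ _S : Fin k → Bool, if x.2.2.1 = N *ᵥ v then (1 : ℝ) else 0) =
      2 ^ k * ALG.successProb N v := fun N => by
    simp only [Finset.sum_const, Finset.card_univ, Fintype.card_fun, Fintype.card_bool,
      Fintype.card_fin, nsmul_eq_mul, QueryAlgorithm.successProb, QueryAlgorithm.outputProb,
      Finset.sum_filter, Finset.mul_sum]
    refine Finset.sum_congr rfl fun x _ => ?_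
    split_ifs
    · push_cast
      ring
    · simp
  simp only [h1, ← Finset.mul_sum, QueryAlgorithm.vectorSuccess]
  field_simp

open Classical in
/-- The trials followed by an arbitrary decoding of their outcomes. -/
theorem exists_queryAlgorithm_trials (T : ℕ) (ALG : QueryAlgorithm F n n)
    (e : Fin n ≃ Fin k × Fin d) (j₀ : Fin d) (l₀ : Fin n)
    (f : (Fin n → F) → (Fin T → Seed F n k × QBasis F n n ALG.work) → Fin d → F) :
    ∃ A : QueryAlgorithm F d n, A.matrixQueries ≤ T * (2 * ALG.matrixQueries) ∧
      A.vectorQueries ≤ 2 * n ∧ ∀ M v, A.successProb M v =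
        ∑ y, if f v y = M *ᵥ v then ∏ t, ‖trialState ALG e M v (y t)‖ ^ 2 else 0 := by
  obtain ⟨A, i, ha, hb, hA⟩ := (reach_trials T ALG e j₀ l₀).ctrlOut
    fun w => Equiv.addRight (f w.1 w.2)
  refine ⟨A, ha, hb, fun M v => ?_⟩
  have hbasis := sum_ite_basis (j₀, l₀, (0 : F)) (l₀, (0 : F)) (f v) v fun s =>
    if s.2.2.1 = M *ᵥ v then ∏ t : Fin T, ‖trialState ALG e M v ((s.2.2.2.2 : Fin T → _) t)‖ ^ 2
      else 0
  rw [← hbasis, QueryAlgorithm.successProb, QueryAlgorithm.outputProb, Finset.sum_filter]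
  refine Fintype.sum_equiv (regBasisCongr i) _ _ fun s => ?_
  rw [hA]
  change _ = if s.1 = _ ∧ s.2.1 = _ ∧ s.2.2.1 = f v (i s.2.2.2).2 ∧ (i s.2.2.2).1 = v then
    if s.2.2.1 = M *ᵥ v then ∏ t, ‖trialState ALG e M v ((i s.2.2.2).2 t)‖ ^ 2 else 0 else 0
  simp only [idle, Equiv.addRight_symm, Equiv.coe_addRight]
  by_cases hv : (i s.2.2.2).1 = v
  · simp only [hv, ← sub_eq_add_neg, sub_eq_zero]
    split_ifs <;> simp [Finset.prod_pow]
  · simp [hv]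

end TrialProbability

section Amplification

/-- With `8 / α` trials, both the chance that no trial is right and the chance that some trial is
bad are small. -/
theorem trials_numerics {k T : ℕ} {α : ℝ} (h0 : 0 < α) (h1 : α ≤ 1)
    (hk : 4 * Real.exp (-(k : ℝ) / 3200) ≤ α) (hT : 8 / α ≤ T) (hT' : T ≤ 9 / α) :
    0.96 ≤ 1 - T * (5 / 6 : ℝ) ^ k - (1 - α / 2) ^ T := by
  set E := Real.exp (-(k : ℝ) / 3200) with hE
  have hE0 : 0 < E := Real.exp_pos _
  have hfirst : (T : ℝ) * (5 / 6 : ℝ) ^ k ≤ 9 / 1024 := by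
    have h56 : (5 / 6 : ℝ) ^ k ≤ E ^ 6 := by
      calc (5 / 6 : ℝ) ^ k ≤ Real.exp (-(1 / 6)) ^ k := by
            gcongr
            linarith [Real.add_one_le_exp (-(1 / 6) : ℝ)]
        _ = Real.exp (k * -(1 / 6)) := (Real.exp_nat_mul _ _).symm
        _ ≤ Real.exp ((6 : ℕ) * (-(k : ℝ) / 3200)) := by
            rw [Real.exp_le_exp]
            have : (0 : ℝ) ≤ k := Nat.cast_nonneg k
            push_cast
            linarith
        _ = E ^ 6 := Real.exp_nat_mul _ _
    have hTE : T * E ≤ 9 / 4 := by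
      rw [le_div_iff₀ h0] at hT'
      nlinarith [(Nat.cast_nonneg T : (0 : ℝ) ≤ T)]
    calc (T : ℝ) * (5 / 6 : ℝ) ^ k ≤ T * E ^ 6 := by gcongr
      _ = T * E * E ^ 5 := by ring
      _ ≤ 9 / 4 * (1 / 4) ^ 5 := by
          gcongr
          linarith
      _ ≤ 9 / 1024 := by norm_num
  have hsecond : (1 - α / 2) ^ T ≤ 1 / 40 := by
    calc (1 - α / 2) ^ T ≤ Real.exp (-(α / 2)) ^ T := by
          gcongr
          · linarith
          · exact Real.one_sub_le_exp_neg _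
      _ = Real.exp (T * -(α / 2)) := (Real.exp_nat_mul _ _).symm
      _ ≤ Real.exp (-4) := by
          rw [Real.exp_le_exp]
          rw [div_le_iff₀ h0] at hT
          linarith
      _ = (Real.exp 1 ^ 4)⁻¹ := by
          rw [Real.exp_neg, ← Real.exp_nat_mul]
          norm_num
      _ ≤ (2.7 ^ 4)⁻¹ := by
          gcongr
          linarith [Real.exp_one_gt_d9]
      _ ≤ 1 / 40 := by norm_num
  norm_num at hfirst hsecond ⊢
  linarith

end Amplification

theorem mainTheorem3 :
    ∃ C : ℝ, 0 < C ∧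
      ∀ (F : Type*) [Field F] [Fintype F] [DecidableEq F]
        (n k d : ℕ) (α : ℝ) (ALG : QueryAlgorithm F n n),
        0 < n → n = k * d →
        0 < α → α ≤ 1 → 4 * Real.exp (-(k : ℝ) / 3200) ≤ α →
        α ≤ ALG.averageSuccess →
        ∃ ALG₂ : QueryAlgorithm F d n,
          (ALG₂.matrixQueries : ℝ) ≤
            C * (α⁻¹ * ((ALG.matrixQueries : ℝ) + (n : ℝ) ^ (3 / 2 : ℝ))) ∧
          (ALG₂.vectorQueries : ℝ) ≤
            C * (α⁻¹ * ((ALG.vectorQueries : ℝ) + (n : ℝ) ^ (3 / 2 : ℝ))) ∧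
          ∀ v : Fin n → F, ALG.IsGood α v →
            ∀ M : Matrix (Fin d) (Fin n) F, 0.96 ≤ ALG₂.successProb M v := by
  classical
  -- `18 = 2 * 9`: each of the at most `9 / α` runs makes two queries per query of `ALG`
  refine ⟨18, by norm_num, ?_⟩
  intro F _ _ _ n k d α ALG hn hnk hα hα1 hk _
  have hd : 0 < d := Nat.pos_of_mul_pos_left (hnk ▸ hn)
  let e : Fin n ≃ Fin k × Fin d := (finCongr hnk).trans finProdFinEquiv.symm
  set T := ⌈8 / α⌉₊ with hT
  have hT8 : 8 / α ≤ T := Nat.le_ceil _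
  have hinv : 1 ≤ α⁻¹ := (one_le_inv₀ hα).2 hα1
  have hT9 : T ≤ 9 / α := by
    have h1 := Nat.ceil_lt_add_one (div_nonneg (by norm_num : (0 : ℝ) ≤ 8) hα.le)
    rw [div_eq_mul_inv] at h1 ⊢
    rw [hT, div_eq_mul_inv]
    linarith
  obtain ⟨A, ha, hb, hA⟩ := exists_queryAlgorithm_trials T ALG e ⟨0, hd⟩ ⟨0, hn⟩
    (decode (fun x => x.2.2.1) e)
  have hn1 : (1 : ℝ) ≤ n := by exact_mod_cast hn
  have hpow : (n : ℝ) ≤ (n : ℝ) ^ (3 / 2 : ℝ) := by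
    conv_lhs => rw [← Real.rpow_one (n : ℝ)]
    exact Real.rpow_le_rpow_of_exponent_le hn1 (by norm_num)
  refine ⟨A, ?_, ?_, fun v hv M => ?_⟩
  · have h1 : (A.matrixQueries : ℝ) ≤ T * (2 * ALG.matrixQueries) := by exact_mod_cast ha
    calc (A.matrixQueries : ℝ) ≤ T * (2 * ALG.matrixQueries) := h1
      _ ≤ 9 / α * (2 * ALG.matrixQueries) := by gcongr
      _ = 18 * (α⁻¹ * ALG.matrixQueries) := by ring
      _ ≤ _ := by
        gcongr
        linarith
  · have h1 : (A.vectorQueries : ℝ) ≤ 2 * n := by exact_mod_cast hb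
    calc (A.vectorQueries : ℝ) ≤ 2 * n := h1
      _ ≤ 18 * (1 * (ALG.vectorQueries + (n : ℝ) ^ (3 / 2 : ℝ))) := by
        have : (0 : ℝ) ≤ ALG.vectorQueries := Nat.cast_nonneg _
        linarith
      _ ≤ _ := by gcongr
  · rw [hA]
    refine (trials_numerics hα hα1 hk hT8 hT9).trans ?_
    exact le_sum_prod_trials (fun y => by positivity) (sum_norm_sq_trialState ALG e M v)
      (prob_badSet_le ALG e M v) (hv.trans_eq (prob_correct_eq ALG e M v).symm)
      fun y hbad hgood => decode_eq hbad hgood
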